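/- Let $\mathcal M=(R,<,0,1,+,\cdot,\dots)$ be an o-minimal expansion of a real closed field; "definable" means definable in $\mathcal M$ with parameters. Equip $R$ with the order topology, $R^n$ with the product topology, and subsets of $R^n$ with the subspace topology. Write $I=[0,1]\subset R$, and let $\partial I^n$ be the set of points of $I^n$ having at least one coordinate equal to $0$ or $1$ (so $\partial I^0=\emptyset$). Let $G$ be a definable group, i.e. a definable set $G\subseteq R^k$ with a group operation whose graph is definable, equipped with its Pillay topology: the topology on $G$ that makes $G$ a topological group and comes from a definable manifold structure on $G$, that is, from finitely many definable homeomorphisms from open sets covering $G$ onto open subsets of $R^d$, for some fixed $d$. Suppose that $G$ is definably connected: its only definable subsets that are both open and closed are $\emptyset$ and $G$. Then $G$ has property $\mathscr P$. That is, $G$ is definably connected and, for every $n\in\mathbb N$ and every continuous definable map $f\colon\partial I^n\to G$ such that $$f(x_1,\dots,x_{i-1},0,x_{i+1},\dots,x_n)=f(x_1,\dots,x_{i-1},1,x_{i+1},\dots,x_n)$$ for all $i\in\{1,\dots,n\}$ and all $x_j\in I$ ($j\ne i$), the map $f$ is definably homotopic to a constant: there are $c\in G$ and a continuous definable map $h\colon\partial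 I^n\times I\to G$ with $h(x,0)=f(x)$ and $h(x,1)=c$ for all $x\in\partial I^n$. -/

import Mathlib

open FirstOrder

namespace OMin

section Definability

variable {R : Type*} (L : FirstOrder.Language) [L.Structure R]

/-- A subset of `R ^ α` is definable if it is given by a first-order `L`-formula with arbitrary
parameters from `R`. -/
def IsDefinable {α : Type*} (S : Set (α → R)) : Prop :=
  (Set.univ : Set R).Definable L S

/-- A function (not necessarily continuous) between subsets of `R ^ α` and `R ^ β` is definable
if its graph, as a subset of `R ^ (α ⊕ β)`, is definable. -/
def IsDefFun {α β : Type*} {X : Set (α → R)} {Y : Set (β → R)} (f : X → Y) : Prop :=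
  IsDefinable L {v : α ⊕ β → R | ∃ x : X, v = Sum.elim (x : α → R) (f x : β → R)}

/-- A function of two variables `X × Y → Z` is definable if its graph, as a subset of
`R ^ (α ⊕ (β ⊕ γ))`, is definable. -/
def IsDefFun₂ {α β γ : Type*} {X : Set (α → R)} {Y : Set (β → R)} {Z : Set (γ → R)}
    (f : X × Y → Z) : Prop :=
  IsDefinable L {v : α ⊕ (β ⊕ γ) → R |
    ∃ p : X × Y, v = Sum.elim (p.1 : α → R) (Sum.elim (p.2 : β → R) (f p : γ → R))}

end Definability

section Structures

/-- Points and open intervals, possibly unbounded, of a linear order. -/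
def IsPointOrOpenInterval {R : Type*} [LinearOrder R] (J : Set R) : Prop :=
  (∃ a, J = {a}) ∨ (∃ a b, J = Set.Ioo a b) ∨ (∃ a, J = Set.Iio a) ∨ (∃ a, J = Set.Ioi a) ∨
    J = Set.univ

/-- The `L`-structure on the ordered field `R` is an o-minimal expansion of `R`: order, addition
and multiplication of `R` are definable, and every definable subset of the line is a finite union
of points and open intervals. -/
structure IsOMinimalExpansion (L : FirstOrder.Language) (R : Type*) [Field R] [LinearOrder R]
    [L.Structure R] : Prop where
  definable_lt : IsDefinable L {v : Fin 2 → R | v 0 < v 1}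
  definable_add : IsDefinable L {v : Fin 3 → R | v 0 + v 1 = v 2}
  definable_mul : IsDefinable L {v : Fin 3 → R | v 0 * v 1 = v 2}
  omin : ∀ S : Set R, (Set.univ : Set R).Definable₁ L S →
    ∃ F : Set (Set R), F.Finite ∧ (∀ J ∈ F, IsPointOrOpenInterval J) ∧ S = ⋃₀ F

end Structures

section Cubes

variable (R : Type*) [Field R] [LinearOrder R] [IsStrictOrderedRing R]

/-- The cube `I ^ n`, where `I = [0, 1] ⊆ R`. -/
def cube (n : ℕ) : Set (Fin n → R) := {x | ∀ i, x i ∈ Set.Icc (0 : R) 1}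

/-- The boundary `∂I ^ n` of the cube. -/
def boundaryCube (n : ℕ) : Set (Fin n → R) := {x | x ∈ cube R n ∧ ∃ i, x i = 0 ∨ x i = 1}

/-- The endpoint `0` of the interval `I = I ^ 1`. -/
def intervalZero : cube R 1 := ⟨fun _ => 0, fun _ => ⟨le_rfl, zero_le_one⟩⟩

/-- The endpoint `1` of the interval `I = I ^ 1`. -/
def intervalOne : cube R 1 := ⟨fun _ => 1, fun _ => ⟨zero_le_one, le_rfl⟩⟩

end Cubes

section Topological

variable {R : Type*} [Field R] [LinearOrder R] [IsStrictOrderedRing R] [TopologicalSpace R]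
variable (L : FirstOrder.Language) [L.Structure R]

/-- A definable set `X` with a topology (not necessarily the subspace topology) is definably
connected if it has no definable clopen subset other than `∅` and `X`. -/
def DefinablyConnected {k : ℕ} (X : Set (Fin k → R)) [τ : TopologicalSpace X] : Prop :=
  ∀ S : Set X, IsDefinable L (Subtype.val '' S) → IsClopen S → S = ∅ ∨ S = Set.univ

/-- Two maps `f, g : Y → X` are definably homotopic: there is a continuous definable
`h : Y × I → X` with `h (·, 0) = f` and `h (·, 1) = g`. -/
def DefHomotopic {m k : ℕ} {Y : Set (Fin m → R)} {X : Set (Fin k → R)}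
    [σ : TopologicalSpace Y] [τ : TopologicalSpace X] (f g : Y → X) : Prop :=
  ∃ h : Y × cube R 1 → X, Continuous h ∧ IsDefFun₂ L h ∧
    (∀ y, h (y, intervalZero R) = f y) ∧ (∀ y, h (y, intervalOne R) = g y)

/-- The torus-gluing identities for a function on `∂I ^ n`: the values at `x` and `y` agree
whenever `x` and `y` differ only in the `i`-th coordinate, which is `0` for `x` and `1` for `y`. -/
def TorusGluing {Z : Type*} {n : ℕ} (f : boundaryCube R n → Z) : Prop :=
  ∀ (i : Fin n) (x y : boundaryCube R n), x.1 i = 0 → y.1 i = 1 →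
    (∀ j, j ≠ i → x.1 j = y.1 j) → f x = f y

/-- Property P of a definable set `X` with a topology: `X` is definably connected and, for every
`n`, every continuous definable `f : ∂I ^ n → X` satisfying the torus-gluing identities is
definably homotopic to a constant. Here `∂I ^ n` has the subspace topology. -/
def PropertyP {k : ℕ} (X : Set (Fin k → R)) [τ : TopologicalSpace X] : Prop :=
  DefinablyConnected L X ∧
    ∀ (n : ℕ) (f : boundaryCube R n → X), Continuous f → IsDefFun L f → TorusGluing f →
      ∃ c : X, DefHomotopic L f (fun _ => c)

/-- `G` is a definable group: a definable set with a group operation whose graph is definable. -/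
structure IsDefinableGroup {k : ℕ} (G : Set (Fin k → R)) [Group G] : Prop where
  definable_carrier : IsDefinable L G
  definable_mul : IsDefFun₂ L (fun p : G × G => p.1 * p.2)

/-- A topology on a definable group `G` is the Pillay topology if it makes `G` a topological group
and is the topology of a definable manifold structure on `G`: it has a finite atlas whose charts
are definable homeomorphisms from open sets covering `G` onto open subsets of some `R ^ d`. -/
structure IsPillayTopology {k : ℕ} (G : Set (Fin k → R)) [Group G] [τ : TopologicalSpace G] :
    Prop where
  isTopologicalGroup : IsTopologicalGroup G
  exists_atlas : ∃ (d N : ℕ) (φ : Fin N → OpenPartialHomeomorph G (Fin d → R)),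
    (∀ g : G, ∃ i, g ∈ (φ i).source) ∧
    ∀ i, IsDefinable L {v : Fin k ⊕ Fin d → R |
      ∃ g ∈ (φ i).source, v = Sum.elim (g : Fin k → R) (φ i g)}

end Topological

end OMin

namespace OMin

/-! It suffices to extend `f` to a continuous definable `F` on the whole cube: composing `F` with
the linear contraction of the cube to the origin gives the homotopy (`isDefFun₂_comp_contraction`).

The extension (`TorusGluing.exists_extension`) corrects a map one face at a time. Let `r i` project
the cube onto the face `x i = 0`. If `F` is already right on some such faces, then `F x * (F (r i
x))⁻¹ * f (r i x)` is also right on the `i`-th one. The earlier faces are not spoiled, because `r i`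
maps each of them into itself. Each correction preserves the gluing identities, so agreement on the
faces through the origin forces agreement on the opposite faces (`TorusGluing.eq_of_faces`). -/

theorem eq_sumElim_iff {α β R : Type*} {v : α ⊕ β → R} {a : α → R} {b : β → R} :
    v = Sum.elim a b ↔ v ∘ Sum.inl = a ∧ v ∘ Sum.inr = b :=
  ⟨by rintro rfl; exact ⟨rfl, rfl⟩, by rintro ⟨rfl, rfl⟩; exact (Sum.elim_comp_inl_inr v).symm⟩

/-! ### Calculus of definable functions -/

section Definability

variable {R : Type*} {L : FirstOrder.Language} [L.Structure R] {α β γ : Type*}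

theorem isDefFun_iff {X : Set (α → R)} {Y : Set (β → R)} {f : X → Y} :
    IsDefFun L f ↔ IsDefinable L {v : α ⊕ β → R |
      ∃ x : X, v ∘ Sum.inl = (x : α → R) ∧ v ∘ Sum.inr = (f x : β → R)} := by
  simp only [IsDefFun, eq_sumElim_iff]

theorem isDefFun₂_iff {X : Set (α → R)} {Y : Set (β → R)} {Z : Set (γ → R)} {f : X × Y → Z} :
    IsDefFun₂ L f ↔ IsDefinable L {v : α ⊕ (β ⊕ γ) → R |
      ∃ p : X × Y, v ∘ Sum.inl = (p.1 : α → R) ∧ (v ∘ Sum.inr) ∘ Sum.inl = (p.2 : β → R) ∧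
        (v ∘ Sum.inr) ∘ Sum.inr = (f p : γ → R)} := by
  simp only [IsDefFun₂, eq_sumElim_iff]

theorem IsDefinable.coord_eq_const (i : α) (a : R) : IsDefinable L {v : α → R | v i = a} :=
  (Set.Definable.singleton_of_mem L (Set.mem_univ a)).preimage_comp (fun _ : Fin 1 => i)

theorem IsDefinable.coord_eq_coord (i j : α) : IsDefinable L {v : α → R | v i = v j} :=
  (Set.Definable.diagonal L Set.univ).preimage_comp ![i, j]

theorem IsDefinable.forall_finite {ι : Type*} [Finite ι] {p : ι → (α → R) → Prop}
    (h : ∀ i, IsDefinable L {v | p i v}) : IsDefinable L {v | ∀ i, p i v} := by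
  rw [Set.ofPred_forall]
  exact Set.definable_iInter_of_finite h

theorem IsDefinable.exists_finite {ι : Type*} [Finite ι] {p : ι → (α → R) → Prop}
    (h : ∀ i, IsDefinable L {v | p i v}) : IsDefinable L {v | ∃ i, p i v} := by
  rw [Set.ofPred_exists]
  exact Set.definable_iUnion_of_finite h

/-- The composite of two definable functions is definable. -/
theorem IsDefFun.comp [Finite β] {X : Set (α → R)} {Y : Set (β → R)} {Z : Set (γ → R)}
    {g : Y → Z} {f : X → Y} (hg : IsDefFun L g) (hf : IsDefFun L f) : IsDefFun L (g ∘ f) := by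
  rw [isDefFun_iff] at *
  -- The quantified tuple `u` is the intermediate point `f x`.
  have key : IsDefinable L {v : α ⊕ γ → R | ∃ u : β → R, Sum.elim v u ∈ _} :=
    ((hf.preimage_comp (Sum.elim (Sum.inl ∘ Sum.inl) Sum.inr)).inter
      (hg.preimage_comp (Sum.elim Sum.inr (Sum.inl ∘ Sum.inr)))).exists_of_finite
  refine (congrArg (IsDefinable L) (Set.ext fun v => ?_)).mp key
  constructor
  · rintro ⟨u, ⟨x, hx, hu⟩, ⟨y, hy, hv⟩⟩
    have : f x = y := Subtype.ext (hu.symm.trans hy)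
    exact ⟨x, hx, by rw [Function.comp_apply, this]; exact hv⟩
  · rintro ⟨x, hx, hv⟩
    exact ⟨f x, ⟨x, hx, rfl⟩, ⟨f x, rfl, hv⟩⟩

/-- Pairing two definable functions with a definable function of two variables. -/
theorem IsDefFun₂.comp {δ : Type*} [Finite β] [Finite γ] {W : Set (α → R)} {X : Set (β → R)}
    {Y : Set (γ → R)} {Z : Set (δ → R)} {m : X × Y → Z} {f : W → X} {g : W → Y}
    (hm : IsDefFun₂ L m) (hf : IsDefFun L f) (hg : IsDefFun L g) :
    IsDefFun L (fun w => m (f w, g w)) := by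
  rw [isDefFun₂_iff] at hm
  rw [isDefFun_iff] at *
  have key : IsDefinable L {v : α ⊕ δ → R | ∃ u : β ⊕ γ → R, Sum.elim v u ∈ _} :=
    (((hf.preimage_comp (Sum.elim (Sum.inl ∘ Sum.inl) (Sum.inr ∘ Sum.inl))).inter
      (hg.preimage_comp (Sum.elim (Sum.inl ∘ Sum.inl) (Sum.inr ∘ Sum.inr)))).inter
      (hm.preimage_comp (Sum.elim (Sum.inr ∘ Sum.inl)
        (Sum.elim (Sum.inr ∘ Sum.inr) (Sum.inl ∘ Sum.inr))))).exists_of_finite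
  refine (congrArg (IsDefinable L) (Set.ext fun v => ?_)).mp key
  constructor
  · rintro ⟨u, ⟨⟨x, hx, hu⟩, ⟨y, hy, hu'⟩⟩, ⟨⟨p, q⟩, hp, hq, hv⟩⟩
    obtain rfl : x = y := Subtype.ext (hx.symm.trans hy)
    obtain rfl : f x = p := Subtype.ext (hu.symm.trans hp)
    obtain rfl : g x = q := Subtype.ext (hu'.symm.trans hq)
    exact ⟨x, hx, hv⟩
  · rintro ⟨x, hx, hv⟩
    exact ⟨Sum.elim (f x) (g x), ⟨⟨x, hx, rfl⟩, ⟨x, hx, rfl⟩⟩, ⟨(f x, g x), rfl, rfl, hv⟩⟩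

/-- The pointwise quotient of definable functions into a definable group is definable. -/
theorem IsDefFun.div {k : ℕ} {G : Set (Fin k → R)} [Group G] (hG : IsDefinableGroup L G)
    {X : Set (α → R)} {f g : X → G} (hf : IsDefFun L f) (hg : IsDefFun L g) :
    IsDefFun L (fun x => f x / g x) := by
  have hm := isDefFun₂_iff.mp hG.definable_mul
  rw [isDefFun_iff] at *
  -- The quotient is the `q` with `q * g x = f x`, so the graph of multiplication suffices; `u` is
  -- the pair `(f x, g x)`.
  have key : IsDefinable L {v : α ⊕ Fin k → R | ∃ u : Fin k ⊕ Fin k → R, Sum.elim v u ∈ _} :=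
    (((hf.preimage_comp (Sum.elim (Sum.inl ∘ Sum.inl) (Sum.inr ∘ Sum.inl))).inter
      (hg.preimage_comp (Sum.elim (Sum.inl ∘ Sum.inl) (Sum.inr ∘ Sum.inr)))).inter
      (hm.preimage_comp (Sum.elim (Sum.inl ∘ Sum.inr)
        (Sum.elim (Sum.inr ∘ Sum.inr) (Sum.inr ∘ Sum.inl))))).exists_of_finite
  refine (congrArg (IsDefinable L) (Set.ext fun v => ?_)).mp key
  constructor
  · rintro ⟨u, ⟨⟨x, hx, hu⟩, ⟨y, hy, hu'⟩⟩, ⟨⟨p, q⟩, hp, hq, hv⟩⟩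
    obtain rfl : x = y := Subtype.ext (hx.symm.trans hy)
    obtain rfl : g x = q := Subtype.ext (hu'.symm.trans hq)
    have hpq : f x = p * g x := Subtype.ext (hu.symm.trans hv)
    exact ⟨x, hx, by rw [hpq, mul_div_cancel_right]; exact hp⟩
  · rintro ⟨x, hx, hv⟩
    refine ⟨Sum.elim (f x) (g x), ⟨⟨x, hx, rfl⟩, ⟨x, hx, rfl⟩⟩, ⟨(f x / g x, g x), hv, rfl, ?_⟩⟩
    simp only [div_mul_cancel]
    rfl

theorem IsDefFun.const [Finite β] {X : Set (α → R)} {Y : Set (β → R)} (hX : IsDefinable L X)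
    (c : Y) : IsDefFun L (fun _ : X => c) := by
  rw [isDefFun_iff]
  have key : IsDefinable L ((fun v : α ⊕ β → R => v ∘ Sum.inl) ⁻¹' X ∩
      {v | ∀ i, v (Sum.inr i) = (c : β → R) i}) :=
    (hX.preimage_comp Sum.inl).inter (IsDefinable.forall_finite fun i => IsDefinable.coord_eq_const _ _)
  refine (congrArg (IsDefinable L) (Set.ext fun v => ?_)).mp key
  constructor
  · rintro ⟨hx, hv⟩
    exact ⟨⟨_, hx⟩, rfl, funext hv⟩
  · rintro ⟨x, hx, hv⟩
    exact ⟨by rw [Set.mem_preimage, hx]; exact x.2, congrFun hv⟩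

end Definability

/-! ### Cubes, faces and gluing -/

section Cubes

variable {R : Type*} [Field R] [LinearOrder R] {L : FirstOrder.Language} [L.Structure R]

theorem isDefinable_cube (hR : IsOMinimalExpansion L R) (n : ℕ) : IsDefinable L (cube R n) := by
  have coord_mem (i : Fin n) : IsDefinable L {v : Fin n → R | 0 ≤ v i ∧ v i ≤ 1} := by
    -- The constants 0 and 1 become auxiliary coordinates, so that only comparisons between
    -- coordinates are needed.
    have key : IsDefinable L {v : Fin n → R | ∃ u : Fin 2 → R, Sum.elim v u ∈
        (({w | w (Sum.inr 0) = 0} ∩ {w | w (Sum.inr 1) = 1}) ∩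
          ({w : Fin n ⊕ Fin 2 → R | w (Sum.inl i) < w (Sum.inr 0)}ᶜ ∩
            {w : Fin n ⊕ Fin 2 → R | w (Sum.inr 1) < w (Sum.inl i)}ᶜ) :
              Set (Fin n ⊕ Fin 2 → R))} :=
      (((IsDefinable.coord_eq_const (Sum.inr 0) 0).inter
        (IsDefinable.coord_eq_const (Sum.inr 1) 1)).inter
        ((hR.definable_lt.preimage_comp ![Sum.inl i, Sum.inr 0]).compl.inter
          (hR.definable_lt.preimage_comp ![Sum.inr 1, Sum.inl i]).compl)).exists_of_finite
    refine (congrArg (IsDefinable L) (Set.ext fun v => ?_)).mp key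
    constructor
    · rintro ⟨u, ⟨h0, h1⟩, h2, h3⟩
      have h0 : u 0 = 0 := h0
      have h1 : u 1 = 1 := h1
      exact ⟨h0 ▸ not_lt.mp h2, h1 ▸ not_lt.mp h3⟩
    · rintro ⟨h0, h1⟩
      exact ⟨![0, 1], ⟨rfl, rfl⟩, not_lt.mpr h0, not_lt.mpr h1⟩
  exact IsDefinable.forall_finite coord_mem

theorem isDefinable_boundaryCube (hR : IsOMinimalExpansion L R) (n : ℕ) :
    IsDefinable L (boundaryCube R n) :=
  (isDefinable_cube hR n).inter (IsDefinable.exists_finite fun i =>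
    (IsDefinable.coord_eq_const i 0).union (IsDefinable.coord_eq_const i 1))

variable {n : ℕ}

/-- The inclusion of the boundary of the cube into the cube. -/
def boundaryInclusion (x : boundaryCube R n) : cube R n := ⟨x.1, x.2.1⟩

theorem isDefFun_boundaryInclusion (hR : IsOMinimalExpansion L R) :
    IsDefFun L (boundaryInclusion (R := R) (n := n)) := by
  rw [isDefFun_iff]
  have key : IsDefinable L ((fun v : Fin n ⊕ Fin n → R => v ∘ Sum.inl) ⁻¹' boundaryCube R n ∩
      {v | ∀ j : Fin n, v (Sum.inr j) = v (Sum.inl j)}) :=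
    ((isDefinable_boundaryCube hR n).preimage_comp Sum.inl).inter
      (IsDefinable.forall_finite fun j => IsDefinable.coord_eq_coord _ _)
  refine (congrArg (IsDefinable L) (Set.ext fun v => ?_)).mp key
  constructor
  · rintro ⟨hx, hv⟩
    exact ⟨⟨_, hx⟩, rfl, funext hv⟩
  · rintro ⟨x, hx, hv⟩
    exact ⟨by rw [Set.mem_preimage, hx]; exact x.2, fun j => congrFun (hv.trans hx.symm) j⟩

theorem continuous_boundaryInclusion [TopologicalSpace R] : Continuous (boundaryInclusion (R := R) (n := n)) :=
  continuous_subtype_val.subtype_mk _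

/-- The torus-gluing identities for a function on the whole cube. -/
def CubeGluing {Z : Type*} (F : cube R n → Z) : Prop :=
  ∀ (i : Fin n) (x y : cube R n), x.1 i = 0 → y.1 i = 1 →
    (∀ j, j ≠ i → x.1 j = y.1 j) → F x = F y

theorem CubeGluing.torusGluing {Z : Type*} {F : cube R n → Z} (hF : CubeGluing F) :
    TorusGluing (F ∘ boundaryInclusion) :=
  fun i _ _ hx hy hxy => hF i _ _ hx hy hxy

variable [IsStrictOrderedRing R]

/-- The projection of the cube onto its face where the `i`-th coordinate vanishes. -/
def toFace (i : Fin n) (x : cube R n) : boundaryCube R n :=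
  ⟨Function.update x.1 i 0, fun j => by
    rcases eq_or_ne j i with rfl | h
    · simp
    · simpa [h] using x.2 j, i, by simp⟩

theorem toFace_of_eq_zero {i : Fin n} {x : boundaryCube R n} (h : x.1 i = 0) :
    toFace i (boundaryInclusion x) = x :=
  Subtype.ext (by simp [toFace, boundaryInclusion, ← h])

theorem isDefFun_toFace (hR : IsOMinimalExpansion L R) (i : Fin n) :
    IsDefFun L (toFace (R := R) i) := by
  rw [isDefFun_iff]
  have key : IsDefinable L (((fun v : Fin n ⊕ Fin n → R => v ∘ Sum.inl) ⁻¹' cube R n ∩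
      {v | v (Sum.inr i) = 0}) ∩ {v | ∀ j : {j // j ≠ i}, v (Sum.inr j) = v (Sum.inl j)}) :=
    (((isDefinable_cube hR n).preimage_comp Sum.inl).inter (IsDefinable.coord_eq_const _ _)).inter
      (IsDefinable.forall_finite fun j => IsDefinable.coord_eq_coord _ _)
  refine (congrArg (IsDefinable L) (Set.ext fun v => ?_)).mp key
  constructor
  · rintro ⟨⟨hx, h0⟩, hv⟩
    refine ⟨⟨_, hx⟩, rfl, funext fun j => ?_⟩
    rcases eq_or_ne j i with rfl | h
    · simpa [toFace] using h0
    · simpa [toFace, h] using hv ⟨j, h⟩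
  · rintro ⟨x, hx, hv⟩
    refine ⟨⟨by rw [Set.mem_preimage, hx]; exact x.2, ?_⟩, fun j => ?_⟩
    · simpa [toFace] using congrFun hv i
    · exact (congrFun hv j).trans (by simp [toFace, j.2, ← hx])

theorem toFace_eq_of_agree {i : Fin n} {x y : cube R n} (h : ∀ j, j ≠ i → x.1 j = y.1 j) :
    toFace i x = toFace i y := by
  refine Subtype.ext (funext fun j => ?_)
  rcases eq_or_ne j i with rfl | hj
  · simp [toFace]
  · simpa [toFace, hj] using h j hj

/-- A function on the boundary with the torus-gluing identities, restricted to a face of the cube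
and pulled back to the cube, has the torus-gluing identities. -/
theorem TorusGluing.comp_toFace {Z : Type*} {f : boundaryCube R n → Z} (hf : TorusGluing f)
    (i : Fin n) : CubeGluing (f ∘ toFace i) := by
  intro j x y hx hy hxy
  rcases eq_or_ne j i with rfl | hj
  -- The projection forgets the `i`-th coordinate, so both points have the same image.
  · exact congrArg f (toFace_eq_of_agree hxy)
  · refine hf j _ _ (by simpa [toFace, hj] using hx) (by simpa [toFace, hj] using hy)
      fun l hl => ?_
    rcases eq_or_ne l i with rfl | hli
    · simp [toFace]
    · simpa [toFace, hli] using hxy l hl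

/-- Two functions with the torus-gluing identities agree if they agree on the faces through the
origin. -/
theorem TorusGluing.eq_of_faces {Z : Type*} {f g : boundaryCube R n → Z} (hf : TorusGluing f)
    (hg : TorusGluing g) (h : ∀ i x, x.1 i = 0 → f x = g x) : f = g := by
  funext x
  obtain ⟨i, hi | hi⟩ := x.2.2
  · exact h i x hi
  · have hj (j : Fin n) (hj : j ≠ i) : (toFace i (boundaryInclusion x)).1 j = x.1 j := by
      simp [toFace, boundaryInclusion, hj]
    have h0 : (toFace i (boundaryInclusion x)).1 i = 0 := by simp [toFace]
    rw [← hf i _ x h0 hi hj, ← hg i _ x h0 hi hj, h i _ h0]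

/-! ### Contracting to the origin -/

section Contraction

/-- The linear contraction of the boundary of the cube to the origin, inside the cube. -/
def contraction (p : boundaryCube R n × cube R 1) : cube R n :=
  ⟨fun i => (1 - p.2.1 0) * p.1.1 i, fun i => by
    have h1 := p.2.2 0
    have h2 := p.1.2.1 i
    exact ⟨mul_nonneg (sub_nonneg.mpr h1.2) h2.1,
      mul_le_one₀ (sub_le_self _ h1.1) h2.1 h2.2⟩⟩

theorem contraction_intervalZero (x : boundaryCube R n) :
    contraction (x, intervalZero R) = boundaryInclusion x :=
  Subtype.ext (by simp [contraction, intervalZero, boundaryInclusion])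

theorem contraction_intervalOne (x : boundaryCube R n) :
    contraction (x, intervalOne R) = ⟨0, fun _ => ⟨le_rfl, zero_le_one⟩⟩ :=
  Subtype.ext (by ext; simp [contraction, intervalOne])

theorem continuous_contraction [TopologicalSpace R] [OrderTopology R] :
    Continuous (contraction (R := R) (n := n)) := by
  refine Continuous.subtype_mk (continuous_pi fun i => ?_) _
  exact (continuous_const.sub ((continuous_apply 0).comp
    (continuous_subtype_val.comp continuous_snd))).mul
    ((continuous_apply i).comp (continuous_subtype_val.comp continuous_fst))

theorem isDefFun₂_comp_contraction (hR : IsOMinimalExpansion L R) {β : Type*}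
    {Y : Set (β → R)} {F : cube R n → Y} (hF : IsDefFun L F) :
    IsDefFun₂ L (F ∘ contraction) := by
  rw [isDefFun₂_iff]
  rw [isDefFun_iff] at hF
  -- Here `u` holds the contracted point, then `1 - t` and `1`; the equations `(1 - t) + t = 1` and
  -- `(1 - t) * x i = u i` use only the graphs of addition and multiplication.
  have key : IsDefinable L {v : Fin n ⊕ (Fin 1 ⊕ β) → R | ∃ u : Fin n ⊕ Fin 2 → R,
      Sum.elim v u ∈ _} :=
    (((((isDefinable_boundaryCube hR n).preimage_comp (Sum.inl ∘ Sum.inl)).inter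
      ((isDefinable_cube hR 1).preimage_comp (Sum.inl ∘ Sum.inr ∘ Sum.inl))).inter
      (hF.preimage_comp (Sum.elim (Sum.inr ∘ Sum.inl) (Sum.inl ∘ Sum.inr ∘ Sum.inr)))).inter
      ((IsDefinable.coord_eq_const (Sum.inr (Sum.inr 1)) 1).inter
        (hR.definable_add.preimage_comp
          ![Sum.inr (Sum.inr 0), Sum.inl (Sum.inr (Sum.inl 0)), Sum.inr (Sum.inr 1)]))).inter
      (IsDefinable.forall_finite fun i : Fin n => hR.definable_mul.preimage_comp
        ![Sum.inr (Sum.inr 0), Sum.inl (Sum.inl i), Sum.inr (Sum.inl i)])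
      |>.exists_of_finite
  refine (congrArg (IsDefinable L) (Set.ext fun v => ?_)).mp key
  constructor
  · rintro ⟨u, ⟨⟨⟨hx, ht⟩, ⟨y, hy, hv⟩⟩, h1, hadd⟩, hmul⟩
    have h1 : u (Sum.inr 1) = 1 := h1
    have hadd : u (Sum.inr 0) + v (Sum.inr (Sum.inl 0)) = u (Sum.inr 1) := hadd
    have hmul : ∀ i, u (Sum.inr 0) * v (Sum.inl i) = u (Sum.inl i) := hmul
    refine ⟨(⟨_, hx⟩, ⟨_, ht⟩), rfl, rfl, ?_⟩
    have : y = contraction (⟨_, hx⟩, ⟨_, ht⟩) := Subtype.ext <| hy.symm.trans <| funext fun i => by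
      rw [h1, ← eq_sub_iff_add_eq] at hadd
      exact (hmul i).symm.trans (by rw [hadd]; rfl)
    rw [Function.comp_apply, ← this]
    exact hv
  · rintro ⟨⟨x, t⟩, hx, ht, hv⟩
    have hx' (i) : v (Sum.inl i) = x.1 i := congrFun hx i
    have ht' : v (Sum.inr (Sum.inl 0)) = t.1 0 := congrFun ht 0
    refine ⟨Sum.elim (contraction (x, t)) ![1 - t.1 0, 1], ⟨⟨⟨?_, ?_⟩, ⟨_, rfl, hv⟩⟩, rfl, ?_⟩, ?_⟩
    · change v ∘ Sum.inl ∈ boundaryCube R n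
      exact hx ▸ x.2
    · change (v ∘ Sum.inr) ∘ Sum.inl ∈ cube R 1
      exact ht ▸ t.2
    · change 1 - t.1 0 + v (Sum.inr (Sum.inl 0)) = 1
      rw [ht', sub_add_cancel]
    · intro i
      change (1 - t.1 0) * v (Sum.inl i) = (1 - t.1 0) * x.1 i
      rw [hx']

end Contraction

/-! ### Extension from the boundary to the cube -/

variable [TopologicalSpace R]

theorem continuous_toFace (i : Fin n) : Continuous (toFace (R := R) i) :=
  (continuous_subtype_val.update i continuous_const).subtype_mk _

/-- A continuous definable map from the boundary of the cube to a definable topological group that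
satisfies the torus-gluing identities extends to a continuous definable map on the cube. -/
theorem TorusGluing.exists_extension (hR : IsOMinimalExpansion L R)
    {k : ℕ} {G : Set (Fin k → R)} [Group G] (hG : IsDefinableGroup L G) [TopologicalSpace G]
    [IsTopologicalGroup G] {f : boundaryCube R n → G} (hc : Continuous f) (hd : IsDefFun L f)
    (hf : TorusGluing f) :
    ∃ F : cube R n → G, Continuous F ∧ IsDefFun L F ∧ F ∘ boundaryInclusion = f := by
  -- Gluing of `F` is carried along because it is what yields the faces `x i = 1` at the end.
  suffices H : ∀ s : Finset (Fin n), ∃ F : cube R n → G, Continuous F ∧ IsDefFun L F ∧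
      CubeGluing F ∧ ∀ i ∈ s, ∀ x, x.1 i = 0 → F (boundaryInclusion x) = f x by
    obtain ⟨F, hFc, hFd, hFg, hF⟩ := H Finset.univ
    exact ⟨F, hFc, hFd, hFg.torusGluing.eq_of_faces hf fun i => hF i (Finset.mem_univ i)⟩
  intro s
  induction s using Finset.induction_on with
  | empty =>
    exact ⟨fun _ => 1, continuous_const, .const (isDefinable_cube hR n) 1,
      fun _ _ _ _ _ _ => rfl, by simp⟩
  | insert i s _ ih =>
    obtain ⟨F, hFc, hFd, hFg, hF⟩ := ih
    have hr := isDefFun_toFace hR i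
    refine ⟨fun x => F x / (F ∘ boundaryInclusion) (toFace i x) * f (toFace i x), ?_, ?_, ?_, ?_⟩
    · exact (hFc.div' ((hFc.comp continuous_boundaryInclusion).comp (continuous_toFace i))).mul
        (hc.comp (continuous_toFace i))
    · exact hG.definable_mul.comp
        (.div hG hFd ((hFd.comp (isDefFun_boundaryInclusion hR)).comp hr)) (hd.comp hr)
    · intro j x y hx hy hxy
      exact congrArg₂ (· * ·) (congrArg₂ (· / ·) (hFg j x y hx hy hxy)
        (hFg.torusGluing.comp_toFace i j x y hx hy hxy)) (hf.comp_toFace i j x y hx hy hxy)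
    · intro j hj x hx
      by_cases hxi : x.1 i = 0
      -- On the new face `x` is its own projection, so the first two factors cancel and `f x`
      -- remains.
      · simp [toFace_of_eq_zero hxi]
      · have hji : j ≠ i := fun h => hxi (h ▸ hx)
        have hjs : j ∈ s := (Finset.mem_insert.mp hj).resolve_left hji
        -- On an old face the projection stays in that face, where `F` is already `f`; the last two
        -- factors cancel and leave `F x = f x`.
        have h0 : (toFace i (boundaryInclusion x)).1 j = 0 := by
          simpa [toFace, boundaryInclusion, hji] using hx
        simp [hF j hjs _ h0, hF j hjs x hx]

end Cubes

end OMin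

/-- Every definably connected definable group, with its Pillay topology, in an o-minimal expansion
of a real closed field has property P. -/
theorem mainTheorem10 {R : Type*} [Field R] [LinearOrder R] [IsStrictOrderedRing R]
    [IsRealClosed R] [TopologicalSpace R] [OrderTopology R]
    (L : FirstOrder.Language) [L.Structure R] (hR : OMin.IsOMinimalExpansion L R)
    {k : ℕ} (G : Set (Fin k → R)) [Group G] (hG : OMin.IsDefinableGroup L G)
    [τ : TopologicalSpace G] (hτ : OMin.IsPillayTopology L G)
    (hconn : OMin.DefinablyConnected L G) :
    OMin.PropertyP L G := by
  refine ⟨hconn, fun n f hc hd hf => ?_⟩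
  have := hτ.isTopologicalGroup
  obtain ⟨F, hFc, hFd, hF⟩ := hf.exists_extension hR hG hc hd
  refine ⟨F ⟨0, fun _ => ⟨le_rfl, zero_le_one⟩⟩, F ∘ OMin.contraction,
    hFc.comp OMin.continuous_contraction, OMin.isDefFun₂_comp_contraction hR hFd,
    fun x => ?_, fun x => ?_⟩
  · rw [Function.comp_apply, OMin.contraction_intervalZero]
    exact congrFun hF x
  · rw [Function.comp_apply, OMin.contraction_intervalOne]
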